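/- Let $X$ be a smooth connected manifold without boundary with a complete Riemannian metric, and let $\Gamma$ be a finitely generated torsion-free nilpotent group acting on $X$ smoothly, by isometries, freely, properly discontinuously and co-compactly. Let $L:TX\to\mathbb R$ be a $\Gamma$-invariant Tonelli Lagrangian ($C^2$, with positive definite second derivative along the fibres, and uniformly superlinear along the fibres), and fix $x_0\in X$. For $\varepsilon,S>0$ and $y,x\in X$ let $$\phi^\varepsilon(y,x,S)=\inf\Big\{\int_0^S L(\eta(s),\varepsilon\dot\eta(s))\,ds \;:\; \eta\in C^1([0,S],X),\ \eta(0)=y,\ \eta(S)=x\Big\}.$$ Let $G$ be the Malcev closure of $\Gamma$ (the simply connected nilpotent Lie group containing $\Gamma$ as a discrete co-compact subgroup), $\mathfrak g$ its Lie algebra, $\mathfrak g^{(1)}=\mathfrak g$, $\mathfrak g^{(i+1)}=[\mathfrak g,\mathfrak g^{(i)}]$, let $\mathfrak g_\infty=\bigoplus_{i\ge1}\mathfrak g^{(i)}/\mathfrak g^{(i+1)}$ be the associated graded Lie algebra, $G_\infty$ the simply connected Lie group with Lie algebra $\mathfrak g_\infty$, and $\log_\infty$ the inverse of its exponential map $\exp_\infty$.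 For $t\in\mathbb R$ let $\delta_t$ be the dilation of $\mathfrak g_\infty$ that is multiplication by $t^i$ on $\mathfrak g^{(i)}/\mathfrak g^{(i+1)}$, and put $\delta_t=\exp_\infty\circ\,\delta_t\circ\log_\infty$ on $G_\infty$. Choose subspaces $W_i$ with $\mathfrak g^{(i)}=\mathfrak g^{(i+1)}\oplus W_i$ and let $\Lambda:\mathfrak g_\infty\to\mathfrak g$ be the induced linear identification (each class in $\mathfrak g^{(i)}/\mathfrak g^{(i+1)}$ is sent to its representative in $W_i$). Choose a compact fundamental domain $\Omega\ni e$ for the action of $\Gamma$ on $G$ by left translations and, for every $g\in G$, an element $s(g)\in\Gamma$ with $g\in s(g)\,\Omega$. For $\varepsilon>0$ and $\bar x\in G_\infty$ put $$h_\varepsilon(\bar x)=s\big(\exp_G(\Lambda(\delta_{1/\varepsilon}(\log_\infty\bar x)))\big)\in\Gamma .$$ The generalized time-$T$ $\beta$-function is $$\bar b(\bar x,T)=\lim_{\varepsilon\to0^+}\phi^\varepsilon\big(x_0,\,h_\varepsilon(\bar x)\cdot x_0,\,T\big)\qquad(\bar x\in G_\infty,\ T>0),$$ which is said to exist at $(\bar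 x,T)$ if this limit exists in $\mathbb R$. **Proposition.** Let $S,T>0$ and $\bar x\in G_\infty$. Then $\bar b(\bar x,S)$ exists if and only if $\bar b(\delta_{T/S}(\bar x),T)$ exists, and in this case $$\frac1S\,\bar b(\bar x,S)=\frac1T\,\bar b\big(\delta_{T/S}(\bar x),T\big).$$ In particular, for each $T>0$ and $\bar x\in G_\infty$ for which $\bar b(\bar x,T)$ exists, $$\bar b(\bar x,T)=T\,\bar b\big(\delta_{1/T}(\bar x),1\big).$$ -/

import Mathlib

open Set Filter Topology
open Bundle
open scoped Manifold ContDiff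

noncomputable section

/-! ### The graded Lie algebra of a Lie algebra -/

section Graded

variable (𝔤 : Type*) [LieRing 𝔤] [LieAlgebra ℝ 𝔤]

/-- The `i`-th term (counted from `i = 0`, so `lcsTerm 𝔤 0 = 𝔤` and
`lcsTerm 𝔤 (i + 1) = [𝔤, lcsTerm 𝔤 i]`) of the descending central series of `𝔤`,
as a vector subspace. -/
def lcsTerm (i : ℕ) : Submodule ℝ 𝔤 :=
  (LieModule.lowerCentralSeries ℝ 𝔤 𝔤 i).toSubmodule

/-- The `(i+1)`-st term of the descending central series, as a subspace of the `i`-th one. -/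
def lcsNext (i : ℕ) : Submodule ℝ (lcsTerm 𝔤 i) :=
  (lcsTerm 𝔤 (i + 1)).submoduleOf (lcsTerm 𝔤 i)

/-- The `i`-th stratum (counted from `0`): the quotient of two consecutive terms of the
descending central series. -/
abbrev Stratum (i : ℕ) : Type _ := lcsTerm 𝔤 i ⧸ lcsNext 𝔤 i

/-- The graded Lie algebra associated to `𝔤`: the direct sum of the quotients of consecutive
terms of the descending central series. (If `𝔤` is nilpotent of class `r`, only the first
`r` summands are nonzero.) -/
def AssocGradedLie : Type _ := DirectSum ℕ (Stratum 𝔤)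

instance : AddCommGroup (AssocGradedLie 𝔤) :=
  inferInstanceAs (AddCommGroup (DirectSum ℕ (Stratum 𝔤)))

instance : Module ℝ (AssocGradedLie 𝔤) :=
  inferInstanceAs (Module ℝ (DirectSum ℕ (Stratum 𝔤)))

variable {𝔤}

theorem lie_mem_lcsTerm {i j : ℕ} {x y : 𝔤} (hx : x ∈ lcsTerm 𝔤 i) (hy : y ∈ lcsTerm 𝔤 j) :
    ⁅x, y⁆ ∈ lcsTerm 𝔤 (i + j + 1) := by
  have step : ∀ (k : ℕ) (a b : 𝔤), b ∈ lcsTerm 𝔤 k → ⁅a, b⁆ ∈ lcsTerm 𝔤 (k + 1) := by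
    intro k a b hb
    simp only [lcsTerm, LieSubmodule.mem_toSubmodule, LieModule.lowerCentralSeries_succ] at hb ⊢
    exact LieSubmodule.lie_mem_lie (LieSubmodule.mem_top a) hb
  induction i generalizing x j y with
  | zero => simpa using step j x y hy
  | succ i ih =>
    have hx' : x ∈ Submodule.span ℝ
        {⁅(a : 𝔤), (b : 𝔤)⁆ | (a : (⊤ : LieIdeal ℝ 𝔤))
          (b : LieModule.lowerCentralSeries ℝ 𝔤 𝔤 i)} := by
      rw [← LieSubmodule.lieIdeal_oper_eq_linear_span, ← LieModule.lowerCentralSeries_succ]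
      exact hx
    induction hx' using Submodule.span_induction with
    | mem x h =>
      obtain ⟨a, b, rfl⟩ := h
      have h1 : ⁅(b : 𝔤), y⁆ ∈ lcsTerm 𝔤 (i + j + 1) := ih b.2 hy
      have h2 : ⁅(b : 𝔤), ⁅(a : 𝔤), y⁆⁆ ∈ lcsTerm 𝔤 (i + (j + 1) + 1) := ih b.2 (step j _ _ hy)
      have h3 := step _ (a : 𝔤) _ h1
      have e : ⁅⁅(a : 𝔤), (b : 𝔤)⁆, y⁆ = ⁅(a : 𝔤), ⁅(b : 𝔤), y⁆⁆ - ⁅(b : 𝔤), ⁅(a : 𝔤), y⁆⁆ := by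
        rw [leibniz_lie (a : 𝔤) (b : 𝔤) y]; abel
      have hidx : i + 1 + j + 1 = i + j + 1 + 1 := by omega
      have hidx' : i + (j + 1) + 1 = i + j + 1 + 1 := by omega
      rw [hidx'] at h2
      rw [hidx]
      change ⁅⁅(a : 𝔤), (b : 𝔤)⁆, y⁆ ∈ _
      rw [e]
      exact Submodule.sub_mem _ h3 h2
    | zero => simp
    | add u v hu hv h1 h2 =>
      rw [add_lie]
      exact Submodule.add_mem _
        (h1 (by rwa [← LieSubmodule.lieIdeal_oper_eq_linear_span,
          ← LieModule.lowerCentralSeries_succ] at hu))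
        (h2 (by rwa [← LieSubmodule.lieIdeal_oper_eq_linear_span,
          ← LieModule.lowerCentralSeries_succ] at hv))
    | smul c u hu h1 =>
      rw [smul_lie]
      exact Submodule.smul_mem _ c
        (h1 (by rwa [← LieSubmodule.lieIdeal_oper_eq_linear_span,
          ← LieModule.lowerCentralSeries_succ] at hu))

variable (𝔤) in
/-- The inclusion of the `i`-th stratum into the graded Lie algebra. -/
def gradedOf (i : ℕ) : Stratum 𝔤 i →ₗ[ℝ] AssocGradedLie 𝔤 :=
  DirectSum.lof ℝ ℕ (Stratum 𝔤) i

/-- The linear map on the graded Lie algebra with given restrictions to the strata. -/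
def gradedLift {M : Type*} [AddCommGroup M] [Module ℝ M] (f : ∀ i, Stratum 𝔤 i →ₗ[ℝ] M) :
    AssocGradedLie 𝔤 →ₗ[ℝ] M :=
  DirectSum.toModule ℝ ℕ M f

@[simp]
theorem gradedLift_of {M : Type*} [AddCommGroup M] [Module ℝ M]
    (f : ∀ i, Stratum 𝔤 i →ₗ[ℝ] M) (i : ℕ) (v : Stratum 𝔤 i) :
    gradedLift f (gradedOf 𝔤 i v) = f i v :=
  DirectSum.toModule_lof ℝ i v

/-- The class in the `i`-th stratum of an element of the `i`-th term of the descending central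
series, as an element of the graded Lie algebra. -/
def gradedClass (i : ℕ) : lcsTerm 𝔤 i →ₗ[ℝ] AssocGradedLie 𝔤 :=
  gradedOf 𝔤 i ∘ₗ (lcsNext 𝔤 i).mkQ

theorem gradedClass_congr {i j : ℕ} (h : i = j) {x y : 𝔤} (hxy : x = y)
    (hx : x ∈ lcsTerm 𝔤 i) (hy : y ∈ lcsTerm 𝔤 j) :
    gradedClass i ⟨x, hx⟩ = gradedClass j ⟨y, hy⟩ := by
  subst h; subst hxy; rfl

theorem gradedClass_eq_zero {i : ℕ} {x : 𝔤} (hx : x ∈ lcsTerm 𝔤 i)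
    (hx' : x ∈ lcsTerm 𝔤 (i + 1)) : gradedClass i ⟨x, hx⟩ = 0 := by
  have : (lcsNext 𝔤 i).mkQ ⟨x, hx⟩ = 0 := by
    rw [Submodule.mkQ_apply, Submodule.Quotient.mk_eq_zero]
    exact hx'
  rw [gradedClass, LinearMap.comp_apply, this, map_zero]

/-- The bracket of representatives. -/
def bracketRep (i j : ℕ) : lcsTerm 𝔤 i →ₗ[ℝ] lcsTerm 𝔤 j →ₗ[ℝ] AssocGradedLie 𝔤 :=
  LinearMap.mk₂ ℝ
    (fun x y => gradedClass (i + j + 1) ⟨⁅(x : 𝔤), (y : 𝔤)⁆, lie_mem_lcsTerm x.2 y.2⟩)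
    (fun x x' y => by rw [← map_add]; congr 1; ext; simp)
    (fun c x y => by rw [← map_smul]; congr 1; ext; simp)
    (fun x y y' => by rw [← map_add]; congr 1; ext; simp)
    (fun c x y => by rw [← map_smul]; congr 1; ext; simp)

/-- The bracket of two strata. -/
def bracketStrata (i j : ℕ) : Stratum 𝔤 i →ₗ[ℝ] Stratum 𝔤 j →ₗ[ℝ] AssocGradedLie 𝔤 :=
  (lcsNext 𝔤 i).liftQ
    (((lcsNext 𝔤 j).liftQ (bracketRep i j).flip (by
      intro y hy
      ext x
      refine gradedClass_eq_zero _ ?_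
      have := lie_mem_lcsTerm x.2 (show (y : 𝔤) ∈ lcsTerm 𝔤 (j + 1) from hy)
      exact this)).flip) (by
      intro x hx
      ext y
      refine gradedClass_eq_zero _ ?_
      have := lie_mem_lcsTerm (show (x : 𝔤) ∈ lcsTerm 𝔤 (i + 1) from hx) y.2
      rwa [show i + 1 + j + 1 = i + j + 1 + 1 by omega] at this)

/-- The bracket of the graded Lie algebra, as a bilinear map. -/
def gradedBracket :
    AssocGradedLie 𝔤 →ₗ[ℝ] AssocGradedLie 𝔤 →ₗ[ℝ] AssocGradedLie 𝔤 :=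
  gradedLift fun i => (gradedLift fun j => (bracketStrata i j).flip).flip

instance : Bracket (AssocGradedLie 𝔤) (AssocGradedLie 𝔤) where
  bracket x y := gradedBracket x y

/-- The characterizing property of the bracket of the graded Lie algebra. -/
theorem lie_gradedClass {i j : ℕ} (x : lcsTerm 𝔤 i) (y : lcsTerm 𝔤 j) :
    ⁅gradedClass i x, gradedClass j y⁆ =
      gradedClass (i + j + 1) ⟨⁅(x : 𝔤), (y : 𝔤)⁆, lie_mem_lcsTerm x.2 y.2⟩ := by
  change gradedBracket (gradedOf 𝔤 i ((lcsNext 𝔤 i).mkQ x))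
    (gradedOf 𝔤 j ((lcsNext 𝔤 j).mkQ y)) = _
  rw [gradedBracket, gradedLift_of, LinearMap.flip_apply, gradedLift_of]
  rfl

theorem graded_induction {p : AssocGradedLie 𝔤 → Prop} (h0 : p 0)
    (h1 : ∀ (i : ℕ) (x : lcsTerm 𝔤 i), p (gradedClass i x))
    (h2 : ∀ x y, p x → p y → p (x + y)) (x : AssocGradedLie 𝔤) : p x := by
  refine DirectSum.induction_on x h0 (fun i v => ?_) h2
  obtain ⟨v, rfl⟩ := (lcsNext 𝔤 i).mkQ_surjective v
  exact h1 i v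

instance : LieRing (AssocGradedLie 𝔤) where
  add_lie x y z := by
    change gradedBracket (x + y) z = gradedBracket x z + gradedBracket y z
    simp
  lie_add x y z := by
    change gradedBracket x (y + z) = gradedBracket x y + gradedBracket x z
    simp
  lie_self x := by
    have hadd : ∀ x y z : AssocGradedLie 𝔤, ⁅x + y, z⁆ = ⁅x, z⁆ + ⁅y, z⁆ := fun x y z => by
      change gradedBracket (x + y) z = gradedBracket x z + gradedBracket y z
      simp
    have hadd' : ∀ x y z : AssocGradedLie 𝔤, ⁅x, y + z⁆ = ⁅x, y⁆ + ⁅x, z⁆ := fun x y z => by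
      change gradedBracket x (y + z) = gradedBracket x y + gradedBracket x z
      simp
    have h0 : ∀ x : AssocGradedLie 𝔤, ⁅x, 0⁆ = (0 : AssocGradedLie 𝔤) := fun x => by
      change gradedBracket x 0 = 0
      simp
    have h0' : ∀ x : AssocGradedLie 𝔤, ⁅(0 : AssocGradedLie 𝔤), x⁆ = 0 := fun x => by
      change gradedBracket 0 x = 0
      simp
    have skew : ∀ x y : AssocGradedLie 𝔤, ⁅x, y⁆ + ⁅y, x⁆ = 0 := by
      intro x y
      induction x using graded_induction with
      | h0 => rw [h0, h0', add_zero]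
      | h2 a b ha hb =>
        rw [hadd, hadd', add_add_add_comm, ha, hb, add_zero]
      | h1 i x =>
        induction y using graded_induction with
        | h0 => rw [h0, h0', add_zero]
        | h2 a b ha hb =>
          rw [hadd, hadd', add_add_add_comm, ha, hb, add_zero]
        | h1 j y =>
          rw [lie_gradedClass, lie_gradedClass,
            gradedClass_congr (show j + i + 1 = i + j + 1 by omega)
              (lie_skew (y : 𝔤) (x : 𝔤)).symm _
              (Submodule.neg_mem _ (lie_mem_lcsTerm x.2 y.2)), ← map_add]
          refine (congrArg (gradedClass (i + j + 1)) (Subtype.ext ?_)).trans (map_zero _)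
          change ⁅(x : 𝔤), (y : 𝔤)⁆ + -⁅(x : 𝔤), (y : 𝔤)⁆ = 0
          exact add_neg_cancel _
    induction x using graded_induction with
    | h0 => exact h0 0
    | h1 i x =>
      rw [lie_gradedClass]
      refine (congrArg (gradedClass (i + i + 1)) (Subtype.ext ?_)).trans (map_zero _)
      exact lie_self (x : 𝔤)
    | h2 a b ha hb => rw [hadd, hadd', hadd', ha, hb, zero_add, add_zero, skew]
  leibniz_lie x y z := by
    have hadd : ∀ x y z : AssocGradedLie 𝔤, ⁅x + y, z⁆ = ⁅x, z⁆ + ⁅y, z⁆ := fun x y z => by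
      change gradedBracket (x + y) z = gradedBracket x z + gradedBracket y z
      simp
    have hadd' : ∀ x y z : AssocGradedLie 𝔤, ⁅x, y + z⁆ = ⁅x, y⁆ + ⁅x, z⁆ := fun x y z => by
      change gradedBracket x (y + z) = gradedBracket x y + gradedBracket x z
      simp
    have h0 : ∀ x : AssocGradedLie 𝔤, ⁅x, 0⁆ = (0 : AssocGradedLie 𝔤) := fun x => by
      change gradedBracket x 0 = 0
      simp
    have h0' : ∀ x : AssocGradedLie 𝔤, ⁅(0 : AssocGradedLie 𝔤), x⁆ = 0 := fun x => by
      change gradedBracket 0 x = 0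
      simp
    induction x using graded_induction with
    | h0 => simp only [h0, h0', add_zero]
    | h2 a b ha hb => simp only [hadd, hadd', ha, hb]; abel
    | h1 i x =>
      induction y using graded_induction with
      | h0 => simp only [h0, h0', add_zero]
      | h2 a b ha hb => simp only [hadd, hadd', ha, hb]; abel
      | h1 j y =>
        induction z using graded_induction with
        | h0 => simp only [h0, add_zero]
        | h2 a b ha hb => simp only [hadd', ha, hb]; abel
        | h1 k z =>
          simp only [lie_gradedClass]
          have m1 := lie_mem_lcsTerm (lie_mem_lcsTerm x.2 y.2) z.2
          have m2 := lie_mem_lcsTerm y.2 (lie_mem_lcsTerm x.2 z.2)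
          have e1 : i + j + 1 + k + 1 = i + (j + k + 1) + 1 := by omega
          have e2 : j + (i + k + 1) + 1 = i + (j + k + 1) + 1 := by omega
          rw [e1] at m1
          rw [e2] at m2
          rw [gradedClass_congr e1 rfl _ m1, gradedClass_congr e2 rfl _ m2, ← map_add]
          congr 1
          ext
          simp

instance : LieAlgebra ℝ (AssocGradedLie 𝔤) where
  lie_smul c x y := by
    change gradedBracket x (c • y) = c • gradedBracket x y
    simp

/-- The dilation `δ_t` of the graded Lie algebra: the linear map which multiplies the `k`-th
stratum by `t ^ k`, where the strata are counted from `k = 1` (that is, `k = i + 1`). -/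
def algDilation (t : ℝ) : AssocGradedLie 𝔤 →ₗ[ℝ] AssocGradedLie 𝔤 :=
  gradedLift fun i => t ^ (i + 1) • gradedOf 𝔤 i

/-- The linear identification of the graded Lie algebra with `𝔤` given by a choice of complements
`W i` of the `(i+1)`-st term of the descending central series in the `i`-th one: each class in the
`i`-th stratum is sent to its representative in `W i`. -/
def gradedToLie (W : ∀ i, Submodule ℝ (lcsTerm 𝔤 i)) (hW : ∀ i, IsCompl (lcsNext 𝔤 i) (W i)) :
    AssocGradedLie 𝔤 →ₗ[ℝ] 𝔤 :=
  gradedLift fun i =>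
    (lcsTerm 𝔤 i).subtype ∘ₗ (W i).subtype ∘ₗ
      (Submodule.quotientEquivOfIsCompl (lcsNext 𝔤 i) (W i) (hW i)).toLinearMap

end Graded

/-! ### The simply connected Lie group of a nilpotent Lie algebra -/

/-- The right-nested bracket `[a₁, [a₂, [… , aₖ]…]]` of a word `a₁ a₂ … aₖ`. -/
def nestedBracket {𝔫 : Type*} [LieRing 𝔫] : List 𝔫 → 𝔫
  | [] => 0
  | [a] => a
  | a :: b :: l => ⁅a, nestedBracket (b :: l)⁆

open scoped Classical in
/-- The Baker-Campbell-Hausdorff product `log (exp x * exp y)` on a nilpotent real Lie algebra,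
given by Dynkin's formula
`∑ₙ (-1)ⁿ⁻¹ / n ∑ [x^p₁ y^q₁ … x^pₙ y^qₙ] / ((∑ (pᵢ + qᵢ)) ∏ pᵢ! qᵢ!)`, where the inner sum is over
all `pᵢ + qᵢ > 0`. Only the terms with `n, pᵢ, qᵢ ≤ c`, where `c` is the nilpotency class, are
written down, since all words of more than `c` letters have bracket `0`. -/
def bchProduct {𝔫 : Type*} [LieRing 𝔫] [LieAlgebra ℝ 𝔫] (x y : 𝔫) : 𝔫 :=
  let c := LieModule.nilpotencyLength 𝔫 𝔫
  ∑ n ∈ Finset.Icc 1 c,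
    ∑ p : Fin n → Fin (c + 1) × Fin (c + 1),
      if ∀ i, 0 < ((p i).1 : ℕ) + ((p i).2 : ℕ) then
        ((-1 : ℝ) ^ (n - 1) / (n : ℝ)
          * ((∑ i, (((p i).1 : ℕ) + ((p i).2 : ℕ)) : ℕ) : ℝ)⁻¹
          * ((∏ i, (Nat.factorial (p i).1 * Nat.factorial (p i).2) : ℕ) : ℝ)⁻¹) •
        nestedBracket ((List.ofFn fun i =>
          List.replicate (p i).1 x ++ List.replicate (p i).2 y).flatten)
      else 0

/-- The graded group of a (nilpotent) Lie algebra `𝔤`: the connected and simply connected Lie group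
whose Lie algebra is the graded Lie algebra of `𝔤`. Since its exponential map is a diffeomorphism,
it is realized in exponential coordinates: an element is `exp v` for a unique element `v = log x`
of the graded Lie algebra, and the group law is the Baker-Campbell-Hausdorff product. -/
@[ext]
structure GradedGroup (𝔤 : Type*) [LieRing 𝔤] [LieAlgebra ℝ 𝔤] where
  /-- The exponential map of the graded group. -/
  exp ::
  /-- The inverse of the exponential map. -/
  log : AssocGradedLie 𝔤

namespace GradedGroup

variable {𝔤 : Type*} [LieRing 𝔤] [LieAlgebra ℝ 𝔤]

instance : One (GradedGroup 𝔤) := ⟨exp 0⟩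

instance : Mul (GradedGroup 𝔤) := ⟨fun x y => exp (bchProduct x.log y.log)⟩

instance : Inv (GradedGroup 𝔤) := ⟨fun x => exp (-x.log)⟩

/-- The group dilation `δ_t = exp ∘ δ_t ∘ log`. -/
def dilation (t : ℝ) (x : GradedGroup 𝔤) : GradedGroup 𝔤 := exp (algDilation t x.log)

end GradedGroup

/-! ### Lie groups and lattices -/

instance lieGroup_minSmoothness {E H : Type*} [NormedAddCommGroup E] [NormedSpace ℝ E]
    [TopologicalSpace H] {I : ModelWithCorners ℝ E H} {G : Type*} [TopologicalSpace G]
    [ChartedSpace H G] [Group G] [LieGroup I ∞ G] : LieGroup I (minSmoothness ℝ 3) G :=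
  LieGroup.of_le (n := ∞) (by
    rw [minSmoothness_of_isRCLikeNormedField]
    exact WithTop.coe_le_coe.2 (le_top : (3 : ℕ∞) ≤ ⊤))

open scoped Classical in
/-- The exponential map of a Lie group: `exp v = γ 1`, where `γ` is the integral curve, starting at
the identity, of the left-invariant vector field given by `v`. -/
def lieExp {E H : Type*} [NormedAddCommGroup E] [NormedSpace ℝ E]
    [TopologicalSpace H] {I : ModelWithCorners ℝ E H} {G : Type*} [TopologicalSpace G]
    [ChartedSpace H G] [Group G] (v : GroupLieAlgebra I G) : G :=
  if h : ∃ γ : ℝ → G, γ 0 = 1 ∧ IsMIntegralCurve γ (mulInvariantVectorField (I := I) v) then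
    h.choose 1
  else 1

/-- `ι` embeds `Γ` as a discrete co-compact subgroup of `G`. If moreover `G` is a simply
connected nilpotent Lie group, then `G` is the Malcev closure of `Γ`. -/
structure IsCocompactLattice {Γ G : Type*} [Group Γ] [Group G] [TopologicalSpace G]
    (ι : Γ →* G) : Prop where
  injective : Function.Injective ι
  discrete : DiscreteTopology ι.range
  cocompact : CompactSpace (G ⧸ ι.range)

/-- `D` is a compact fundamental domain, containing the identity, for the action of `Γ` on `G` by
left translations: the translates of `D` cover `G` and distinct translates have disjoint
interiors. -/
structure IsCompactFundamentalDomain {Γ G : Type*} [Group Γ] [Group G] [TopologicalSpace G]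
    (ι : Γ →* G) (D : Set G) : Prop where
  isCompact : IsCompact D
  one_mem : 1 ∈ D
  covers : ∀ g : G, ∃ γ : Γ, g ∈ (fun z => ι γ * z) '' D
  disjoint : ∀ γ : Γ, γ ≠ 1 → Disjoint (interior ((fun z => ι γ * z) '' D)) (interior D)

/-- The action of `Γ` on `X` is smooth, free, properly discontinuous and co-compact. -/
structure IsGoodAction {E H : Type*} [NormedAddCommGroup E] [NormedSpace ℝ E]
    [TopologicalSpace H] (I : ModelWithCorners ℝ E H) (Γ X : Type*) [Group Γ]
    [TopologicalSpace X] [ChartedSpace H X] [MulAction Γ X] : Prop where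
  smooth : ∀ γ : Γ, ContMDiff I I ∞ (fun x : X => γ • x)
  free : ∀ (γ : Γ) (x : X), γ • x = x → γ = 1
  properlyDiscontinuous : ∀ x : X, ∃ U ∈ 𝓝 x,
    {γ : Γ | (((fun y : X => γ • y) '' U) ∩ U).Nonempty}.Finite
  cocompact : CompactSpace (MulAction.orbitRel.Quotient Γ X)

/-! ### Tonelli Lagrangians and Mañé potentials -/

section Lagrangian

variable {E H : Type*} [NormedAddCommGroup E] [NormedSpace ℝ E]
  [TopologicalSpace H] (I : ModelWithCorners ℝ E H) {X : Type*}
  [TopologicalSpace X] [ChartedSpace H X] [IsManifold I ∞ X]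

/-- A Tonelli Lagrangian: of class `C²`, with positive definite second derivative along the fibres,
and uniformly superlinear along the fibres. -/
structure IsTonelliLagrangian [RiemannianBundle (fun x : X => TangentSpace I x)]
    (L : TangentBundle I X → ℝ) : Prop where
  contMDiff : ContMDiff I.tangent 𝓘(ℝ, ℝ) 2 L
  posDef : ∀ (x : X) (v w : TangentSpace I x), w ≠ 0 →
    0 < iteratedDeriv 2 (fun t : ℝ => L ⟨x, v + t • w⟩) 0
  superlinear : ∀ A : ℝ, 0 ≤ A → ∃ B : ℝ, ∀ (x : X) (v : TangentSpace I x),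
    A * ‖v‖ - B ≤ L ⟨x, v⟩

/-- `L` is invariant under the action `(x, v) ↦ (γ x, d_x γ v)` of `Γ` on the tangent bundle. -/
def IsInvariantLagrangian (Γ : Type*) [Group Γ] [MulAction Γ X]
    (L : TangentBundle I X → ℝ) : Prop :=
  ∀ (γ : Γ) (p : TangentBundle I X), L (tangentMap I I (fun x : X => γ • x) p) = L p

/-- The rescaled action `∫₀ˢ L(η(s), ε η'(s)) ds` of a curve `η` on `[0, S]`. -/
def rescaledAction (L : TangentBundle I X → ℝ) (ε S : ℝ) (η : ℝ → X) : ℝ :=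
  ∫ s in (0 : ℝ)..S,
    L ⟨η s, ε • mfderivWithin 𝓘(ℝ, ℝ) I η (Icc 0 S) s (1 : ℝ)⟩

/-- The rescaled Mañé potential `φ^ε(y, x, S)`: the infimum of the rescaled actions of the curves
of class `C¹` on `[0, S]` from `y` to `x`. -/
def manePotential (L : TangentBundle I X → ℝ) (ε : ℝ) (y x : X) (S : ℝ) : ℝ :=
  sInf {a : ℝ | ∃ η : ℝ → X, ContMDiffOn 𝓘(ℝ, ℝ) I 1 η (Icc 0 S) ∧ η 0 = y ∧ η S = x ∧
    a = rescaledAction I L ε S η}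

end Lagrangian

/-! ### Rescaling maps and the generalized time-`T` β-function -/

/-- The map `G_∞ → G` given by `exp ∘ (identification of Lie algebras) ∘ δ_{1/ε} ∘ log`. -/
def blowUp {E H : Type*} [NormedAddCommGroup E] [NormedSpace ℝ E] [CompleteSpace E]
    [TopologicalSpace H] {I : ModelWithCorners ℝ E H} {G : Type*} [TopologicalSpace G]
    [ChartedSpace H G] [Group G] [LieGroup I ∞ G]
    (W : ∀ i, Submodule ℝ (lcsTerm (GroupLieAlgebra I G) i))
    (hW : ∀ i, IsCompl (lcsNext (GroupLieAlgebra I G) i) (W i))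
    (ε : ℝ) (x : GradedGroup (GroupLieAlgebra I G)) : G :=
  lieExp (I := I) (gradedToLie W hW (algDilation (1 / ε) x.log))

/-- The rescaling map `h_ε : G_∞ → Γ`, where `sel : G → Γ` selects for every `g : G` an
element `γ` of `Γ` with `g ∈ γ D`, for a fixed fundamental domain `D`. -/
def rescalingMap {E H : Type*} [NormedAddCommGroup E] [NormedSpace ℝ E] [CompleteSpace E]
    [TopologicalSpace H] {I : ModelWithCorners ℝ E H} {G : Type*} [TopologicalSpace G]
    [ChartedSpace H G] [Group G] [LieGroup I ∞ G] {Γ : Type*}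
    (W : ∀ i, Submodule ℝ (lcsTerm (GroupLieAlgebra I G) i))
    (hW : ∀ i, IsCompl (lcsNext (GroupLieAlgebra I G) i) (W i)) (sel : G → Γ)
    (ε : ℝ) (x : GradedGroup (GroupLieAlgebra I G)) : Γ :=
  sel (blowUp W hW ε x)

section Beta

variable {E H : Type*} [NormedAddCommGroup E] [NormedSpace ℝ E]
  [TopologicalSpace H] (I : ModelWithCorners ℝ E H) {X : Type*}
  [TopologicalSpace X] [ChartedSpace H X] [IsManifold I ∞ X]
  {Γ : Type*} [Group Γ] [MulAction Γ X] {𝔤 : Type*} [LieRing 𝔤] [LieAlgebra ℝ 𝔤]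

/-- `F_ε(x, T) = φ^ε(x₀, h_ε(x) x₀, T)`. -/
def rescaledPotential (L : TangentBundle I X → ℝ) (x₀ : X) (h : ℝ → GradedGroup 𝔤 → Γ)
    (ε : ℝ) (x : GradedGroup 𝔤) (T : ℝ) : ℝ :=
  manePotential I L ε x₀ (h ε x • x₀) T

/-- The limit defining the generalized time-`T` β-function at `x` exists (in `ℝ`). -/
def GenBetaExists (L : TangentBundle I X → ℝ) (x₀ : X) (h : ℝ → GradedGroup 𝔤 → Γ)
    (x : GradedGroup 𝔤) (T : ℝ) : Prop :=
  ∃ b : ℝ, Tendsto (fun ε => rescaledPotential I L x₀ h ε x T) (𝓝[>] 0) (𝓝 b)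

/-- The generalized time-`T` β-function: the limit of `F_ε(x, T)` as `ε → 0⁺`. It is meaningful
where that limit exists. -/
def genBeta (L : TangentBundle I X → ℝ) (x₀ : X) (h : ℝ → GradedGroup 𝔤 → Γ)
    (x : GradedGroup 𝔤) (T : ℝ) : ℝ :=
  limUnder (𝓝[>] 0) (fun ε => rescaledPotential I L x₀ h ε x T)

end Beta

end

/-! ### Dilations -/

/-! The homogeneity already holds at each fixed `ε`, before any limit is taken. Put `c = T / S`.
Since `δ_{1/(cε)} ∘ δ_c = δ_{1/ε}`, the maps `h_{cε} ∘ δ_c` and `h_ε` pick the very same element of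
`Γ`, so both potentials join the same two points (`rescalingMap_dilation`). Slowing a curve down by
the factor `c` lengthens its time interval from `S` to `cS` and divides its velocity by `c`;
replacing `ε` by `cε` undoes the latter, so the integrand is unchanged and only the factor `c` from
the change of variables remains (`rescaledAction_mul`). Taking infima gives `φ^{cε}(y, x, cS) = c
φ^ε(y, x, S)` (`manePotential_mul`). Together, `F_{cε}(δ_c x, T) = c F_ε(x, S)`. As `ε ↦ cε`
preserves `ε → 0⁺`, one limit exists exactly when the other does, and they differ by the factor `T /
S`. -/

theorem algDilation_algDilation {𝔤 : Type*} [LieRing 𝔤] [LieAlgebra ℝ 𝔤] (s t : ℝ)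
    (v : AssocGradedLie 𝔤) : algDilation s (algDilation t v) = algDilation (s * t) v := by
  induction v using graded_induction with
  | h0 => simp
  | h1 i x =>
    have key : ∀ (r : ℝ) (w : Stratum 𝔤 i),
        algDilation r (gradedOf 𝔤 i w) = r ^ (i + 1) • gradedOf 𝔤 i w := fun r w => by
      rw [algDilation, gradedLift_of, LinearMap.smul_apply]
    simp only [gradedClass, LinearMap.comp_apply, key, map_smul, smul_smul, mul_pow, mul_comm]
  | h2 x y hx hy => simp only [map_add, hx, hy]

theorem rescalingMap_dilation {E H : Type*} [NormedAddCommGroup E] [NormedSpace ℝ E]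
    [CompleteSpace E] [TopologicalSpace H] {I : ModelWithCorners ℝ E H} {G : Type*}
    [TopologicalSpace G] [ChartedSpace H G] [Group G] [LieGroup I ∞ G] {Γ : Type*}
    (W : ∀ i, Submodule ℝ (lcsTerm (GroupLieAlgebra I G) i))
    (hW : ∀ i, IsCompl (lcsNext (GroupLieAlgebra I G) i) (W i)) (sel : G → Γ)
    {c : ℝ} (hc : c ≠ 0) (ε : ℝ) (x : GradedGroup (GroupLieAlgebra I G)) :
    rescalingMap W hW sel (c * ε) (x.dilation c) = rescalingMap W hW sel ε x := by
  -- This also holds at `ε = 0`, where both sides are `0`, so `ε` needs no restriction.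
  have : 1 / (c * ε) * c = 1 / ε := by
    rw [one_div, mul_inv, mul_right_comm, inv_mul_cancel₀ hc, one_mul, one_div]
  simp only [rescalingMap, blowUp, GradedGroup.dilation, algDilation_algDilation, this]

/-! ### Linear reparametrization of curves -/

section Reparametrization

variable {E H : Type*} [NormedAddCommGroup E] [NormedSpace ℝ E]
  [TopologicalSpace H] (I : ModelWithCorners ℝ E H) {X : Type*}
  [TopologicalSpace X] [ChartedSpace H X]

theorem mapsTo_mul_Icc {c S : ℝ} (hc : 0 < c) :
    MapsTo (fun s => c * s) (Icc 0 S) (Icc 0 (c * S)) := fun _ hs =>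
  ⟨mul_nonneg hc.le hs.1, mul_le_mul_of_nonneg_left hs.2 hc.le⟩

variable {I} in
theorem ContMDiffOn.comp_mul_Icc {c S : ℝ} (hc : 0 < c) {η : ℝ → X}
    (hη : ContMDiffOn 𝓘(ℝ, ℝ) I 1 η (Icc 0 (c * S))) :
    ContMDiffOn 𝓘(ℝ, ℝ) I 1 (fun s => η (c * s)) (Icc 0 S) :=
  hη.comp (contDiff_const.mul contDiff_id).contMDiff.contMDiffOn (mapsTo_mul_Icc hc)

/-- Chain rule, including the one-sided derivatives at the endpoints; `0 < S` makes them unique. -/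
theorem mfderivWithin_comp_mul_Icc {c S : ℝ} (hc : 0 < c) (hS : 0 < S) {η : ℝ → X}
    (hη : ContMDiffOn 𝓘(ℝ, ℝ) I 1 η (Icc 0 (c * S))) {s : ℝ} (hs : s ∈ Icc 0 S) :
    (mfderivWithin 𝓘(ℝ, ℝ) I (fun s => η (c * s)) (Icc 0 S) s (1 : ℝ) :
        TangentSpace I (η (c * s))) =
      c • mfderivWithin 𝓘(ℝ, ℝ) I η (Icc 0 (c * S)) (c * s) (1 : ℝ) := by
  have h1 : HasMFDerivWithinAt 𝓘(ℝ, ℝ) I η (Icc 0 (c * S)) (c * s) _ :=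
    ((hη _ (mapsTo_mul_Icc hc hs)).mdifferentiableWithinAt one_ne_zero).hasMFDerivWithinAt
  have h2 : HasMFDerivWithinAt 𝓘(ℝ, ℝ) 𝓘(ℝ, ℝ) (fun s : ℝ => c * s) (Icc 0 S) s
      (c • ContinuousLinearMap.id ℝ ℝ) :=
    ((hasFDerivAt_id s).const_mul c).hasFDerivWithinAt.hasMFDerivWithinAt
  have h3 := (HasMFDerivWithinAt.comp s h1 h2 (mapsTo_mul_Icc hc)).mfderivWithin
    ((uniqueDiffOn_Icc hS).uniqueMDiffOn s hs)
  -- Every tangent space is definitionally the model space `E`, so the derivatives can be evaluated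
  -- there.
  have h4 := congrArg (fun A : ℝ →L[ℝ] E => A 1) h3
  refine h4.trans ?_
  refine Eq.trans ?_
    ((mfderivWithin 𝓘(ℝ, ℝ) I η (Icc 0 (c * S)) (c * s)).map_smul c (1 : ℝ))
  rfl

theorem rescaledAction_mul (L : TangentBundle I X → ℝ) {c S : ℝ} (hc : 0 < c) (hS : 0 < S)
    (ε : ℝ) {η : ℝ → X} (hη : ContMDiffOn 𝓘(ℝ, ℝ) I 1 η (Icc 0 (c * S))) :
    rescaledAction I L (c * ε) (c * S) η = c * rescaledAction I L ε S (fun s => η (c * s)) := by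
  -- Substitution `s ↦ c * s`, the source of the factor `c`; it is valid without integrability.
  have hsub := intervalIntegral.mul_integral_comp_mul_left (a := 0) (b := S) (c := c)
    (f := fun s => L ⟨η s, (c * ε) • mfderivWithin 𝓘(ℝ, ℝ) I η (Icc 0 (c * S)) s (1 : ℝ)⟩)
  rw [mul_zero] at hsub
  rw [rescaledAction, rescaledAction, ← hsub]
  congr 1
  refine intervalIntegral.integral_congr fun s hs => ?_
  rw [uIcc_of_le hS.le] at hs
  -- The two arguments of `L` agree: `ε` times the fast velocity is `cε` times the slow one.
  have h := congrArg (fun v : TangentSpace I (η (c * s)) => ε • v)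
    (mfderivWithin_comp_mul_Icc I hc hS hη hs)
  simp only [smul_smul, mul_comm ε c] at h
  exact congrArg (fun v : TangentSpace I (η (c * s)) => L ⟨η (c * s), v⟩) h.symm

variable [IsManifold I ∞ X]

open scoped Pointwise in
-- Reparametrization is a bijection between the two families of curves, so one set of actions is `c`
-- times the other. Real `sInf` commutes with nonnegative scaling even for empty or unbounded sets,
-- where its value is `0`.
theorem manePotential_mul (L : TangentBundle I X → ℝ) {c S : ℝ} (hc : 0 < c) (hS : 0 < S)
    (ε : ℝ) (y x : X) :
    manePotential I L (c * ε) y x (c * S) = c * manePotential I L ε y x S := by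
  rw [manePotential, manePotential, ← smul_eq_mul c (sInf _), ← Real.sInf_smul_of_nonneg hc.le]
  congr 1
  ext a
  rw [mem_smul_set]
  constructor
  · rintro ⟨η, hη, h0, h1, rfl⟩
    exact ⟨_, ⟨fun s => η (c * s), hη.comp_mul_Icc hc, by simpa using h0, h1, rfl⟩,
      (rescaledAction_mul I L hc hS ε hη).symm⟩
  · rintro ⟨_, ⟨ζ, hζ, h0, h1, rfl⟩, rfl⟩
    have hcS : c⁻¹ * (c * S) = S := inv_mul_cancel_left₀ hc.ne' S
    have hη : ContMDiffOn 𝓘(ℝ, ℝ) I 1 (fun s => ζ (c⁻¹ * s)) (Icc 0 (c * S)) :=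
      ContMDiffOn.comp_mul_Icc (inv_pos.2 hc) (by rwa [hcS])
    refine ⟨_, hη, by simpa using h0, by simpa only [hcS] using h1, ?_⟩
    rw [rescaledAction_mul I L hc hS ε hη]
    simp only [inv_mul_cancel_left₀ hc.ne', smul_eq_mul]

end Reparametrization

/-! ### Homogeneity of the generalized β-function -/

theorem tendsto_nhdsGT_zero_comp_mul_iff {α : Type*} {l : Filter α} {f : ℝ → α} {c : ℝ}
    (hc : 0 < c) : Tendsto (fun ε => f (c * ε)) (𝓝[>] 0) l ↔ Tendsto f (𝓝[>] 0) l := by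
  have key : ∀ {a : ℝ}, 0 < a → Tendsto (fun ε => a * ε) (𝓝[>] (0 : ℝ)) (𝓝[>] 0) := fun {a} ha =>
    tendsto_nhdsWithin_of_tendsto_nhds_of_eventually_within _
      (((continuous_const_mul a).tendsto' 0 0 (mul_zero a)).mono_left nhdsWithin_le_nhds)
      (eventually_mem_nhdsWithin.mono fun _ h => mul_pos ha h)
  refine ⟨fun h => ?_, fun h => h.comp (key hc)⟩
  -- The converse is the substitution `ε ↦ c⁻¹ * ε`.
  refine (h.comp (key (inv_pos.2 hc))).congr fun ε => ?_
  simp only [Function.comp_apply, mul_inv_cancel_left₀ hc.ne']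

section Homogeneity

variable {E H : Type*} [NormedAddCommGroup E] [NormedSpace ℝ E]
  [TopologicalSpace H] (I : ModelWithCorners ℝ E H) {X : Type*}
  [TopologicalSpace X] [ChartedSpace H X] [IsManifold I ∞ X]
  {Γ : Type*} [Group Γ] [MulAction Γ X] {𝔤 : Type*} [LieRing 𝔤] [LieAlgebra ℝ 𝔤]
  (L : TangentBundle I X → ℝ) (x₀ : X) {h : ℝ → GradedGroup 𝔤 → Γ}

/-- The equivariance `hh` is all that is needed of the rescaling maps, so `h` stays abstract. -/
theorem tendsto_rescaledPotential_dilation_iff {c S : ℝ} (hc : 0 < c) (hS : 0 < S)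
    {x : GradedGroup 𝔤} (hh : ∀ ε, h (c * ε) (x.dilation c) = h ε x) (b : ℝ) :
    Tendsto (fun ε => rescaledPotential I L x₀ h ε (x.dilation c) (c * S)) (𝓝[>] 0) (𝓝 (c * b)) ↔
      Tendsto (fun ε => rescaledPotential I L x₀ h ε x S) (𝓝[>] 0) (𝓝 b) := by
  -- With `c * ε` as parameter on the left, the left function becomes exactly `c` times the right
  -- one.
  rw [← tendsto_nhdsGT_zero_comp_mul_iff hc]
  simp only [rescaledPotential, hh, manePotential_mul I L hc hS]
  refine ⟨fun H => ?_, fun H => H.const_mul c⟩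
  simpa only [inv_mul_cancel_left₀ hc.ne'] using H.const_mul c⁻¹

theorem genBetaExists_dilation_iff {c S : ℝ} (hc : 0 < c) (hS : 0 < S)
    {x : GradedGroup 𝔤} (hh : ∀ ε, h (c * ε) (x.dilation c) = h ε x) :
    GenBetaExists I L x₀ h (x.dilation c) (c * S) ↔ GenBetaExists I L x₀ h x S := by
  constructor
  · rintro ⟨b, hb⟩
    -- The limit must have the form `c * b'`; take `b' = c⁻¹ * b`.
    rw [← mul_inv_cancel_left₀ hc.ne' b] at hb
    exact ⟨_, (tendsto_rescaledPotential_dilation_iff I L x₀ hc hS hh _).1 hb⟩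
  · rintro ⟨b, hb⟩
    exact ⟨_, (tendsto_rescaledPotential_dilation_iff I L x₀ hc hS hh b).2 hb⟩

theorem genBeta_dilation {c S : ℝ} (hc : 0 < c) (hS : 0 < S)
    {x : GradedGroup 𝔤} (hh : ∀ ε, h (c * ε) (x.dilation c) = h ε x)
    (hx : GenBetaExists I L x₀ h x S) :
    genBeta I L x₀ h (x.dilation c) (c * S) = c * genBeta I L x₀ h x S := by
  obtain ⟨b, hb⟩ := hx
  -- Existence of the limit is essential: only then is `limUnder` the actual limit.
  rw [genBeta, genBeta, hb.limUnder_eq,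
    ((tendsto_rescaledPotential_dilation_iff I L x₀ hc hS hh b).2 hb).limUnder_eq]

end Homogeneity

theorem mainTheorem5
    {n m : ℕ}
    {X : Type*} [MetricSpace X] [CompleteSpace X] [ConnectedSpace X]
    [ChartedSpace (EuclideanSpace ℝ (Fin n)) X] [IsManifold (𝓡 n) ∞ X]
    [RiemannianBundle (fun x : X => TangentSpace (𝓡 n) x)]
    [IsContMDiffRiemannianBundle (𝓡 n) ∞ (EuclideanSpace ℝ (Fin n))
      (fun x : X => TangentSpace (𝓡 n) x)]
    [IsRiemannianManifold (𝓡 n) X]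
    {Γ : Type*} [Group Γ] [Group.FG Γ] [Group.IsNilpotent Γ]
    (hΓ : ∀ γ : Γ, γ ≠ 1 → ¬ IsOfFinOrder γ)
    [MulAction Γ X] [IsIsometricSMul Γ X] (hact : IsGoodAction (𝓡 n) Γ X)
    (L : TangentBundle (𝓡 n) X → ℝ) (hL : IsTonelliLagrangian (𝓡 n) L)
    (hLΓ : IsInvariantLagrangian (𝓡 n) Γ L)
    {G : Type*} [TopologicalSpace G] [T2Space G] [ChartedSpace (EuclideanSpace ℝ (Fin m)) G]
    [Group G] [LieGroup (𝓡 m) ∞ G] [SimplyConnectedSpace G] [Group.IsNilpotent G]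
    (ι : Γ →* G) (hι : IsCocompactLattice ι)
    (W : ∀ i, Submodule ℝ (lcsTerm (GroupLieAlgebra (𝓡 m) G) i))
    (hW : ∀ i, IsCompl (lcsNext (GroupLieAlgebra (𝓡 m) G) i) (W i))
    (D : Set G) (hD : IsCompactFundamentalDomain ι D)
    (sel : G → Γ) (hsel : ∀ g : G, g ∈ (fun z => ι (sel g) * z) '' D)
    (x₀ : X) :
    (∀ (x : GradedGroup (GroupLieAlgebra (𝓡 m) G)) (S T : ℝ), 0 < S → 0 < T →
      (GenBetaExists (𝓡 n) L x₀ (rescalingMap W hW sel) x S ↔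
        GenBetaExists (𝓡 n) L x₀ (rescalingMap W hW sel) (x.dilation (T / S)) T)) ∧
    (∀ (x : GradedGroup (GroupLieAlgebra (𝓡 m) G)) (S T : ℝ), 0 < S → 0 < T →
      GenBetaExists (𝓡 n) L x₀ (rescalingMap W hW sel) x S →
      1 / S * genBeta (𝓡 n) L x₀ (rescalingMap W hW sel) x S =
        1 / T * genBeta (𝓡 n) L x₀ (rescalingMap W hW sel) (x.dilation (T / S)) T) ∧
    (∀ (x : GradedGroup (GroupLieAlgebra (𝓡 m) G)) (T : ℝ), 0 < T →
      GenBetaExists (𝓡 n) L x₀ (rescalingMap W hW sel) x T →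
      genBeta (𝓡 n) L x₀ (rescalingMap W hW sel) x T =
        T * genBeta (𝓡 n) L x₀ (rescalingMap W hW sel) (x.dilation (1 / T)) 1) := by
  have hh : ∀ {c : ℝ}, 0 < c → ∀ (x : GradedGroup (GroupLieAlgebra (𝓡 m) G)) (ε : ℝ),
      rescalingMap W hW sel (c * ε) (x.dilation c) = rescalingMap W hW sel ε x :=
    fun hc x ε => rescalingMap_dilation W hW sel hc.ne' ε x
  have hscale : ∀ (x : GradedGroup (GroupLieAlgebra (𝓡 m) G)) (S T : ℝ), 0 < S → 0 < T →
      GenBetaExists (𝓡 n) L x₀ (rescalingMap W hW sel) x S →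
      1 / S * genBeta (𝓡 n) L x₀ (rescalingMap W hW sel) x S =
        1 / T * genBeta (𝓡 n) L x₀ (rescalingMap W hW sel) (x.dilation (T / S)) T := by
    intro x S T hS hT hx
    have key := genBeta_dilation (𝓡 n) L x₀ (div_pos hT hS) hS (hh (div_pos hT hS) x) hx
    -- With `c = T / S`, the dilated time `c * S` is `T`.
    rw [div_mul_cancel₀ T hS.ne'] at key
    rw [key]
    field_simp
  refine ⟨fun x S T hS hT => ?_, hscale, fun x T hT hx => ?_⟩
  · have key := genBetaExists_dilation_iff (𝓡 n) L x₀ (div_pos hT hS) hS (hh (div_pos hT hS) x)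
    rw [div_mul_cancel₀ T hS.ne'] at key
    exact key.symm
  -- The normalization to time `1` is the scaling law from time `T` to time `1`.
  · have key := hscale x T 1 hT one_pos hx
    rw [one_div_one, one_mul] at key
    rw [← key, one_div, mul_inv_cancel_left₀ hT.ne']
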